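/- Let $\mathbb K\in\{\mathbb R,\mathbb C\}$ and consider $\ell_1,c_0,\ell_\infty$ over $\mathbb K$, with $\ell_\infty$ identified with $(\ell_1)^*$ through the pairing $\langle y,x\rangle=\sum_i y_i x_i$. Let $(e_n)_{n\in\mathbb N}$ be the canonical basis of $c_0\subset\ell_\infty$, let $\mathfrak F$ be a free filter on $\mathbb N$ (a filter with $\emptyset\notin\mathfrak F$ that contains every cofinite set), and let $(a_n)_{n\in\mathbb N}$ be a sequence of positive reals. Call $I\subset\mathbb N$ *$\mathfrak F$-stationary* if $I\cap A\neq\emptyset$ for every $A\in\mathfrak F$. Let $\mathcal A(w^*,(\ell_1)^*,\mathfrak F)$ be the set of all sequences $(b_n)$ of positive reals for which there are functionals $x_n^*\in(\ell_1)^*$ with $\|x_n^*\|=b_n$ for all $n$ and $\mathfrak F\text{-}\lim_n x_n^*=0$ in the weak* topology $\sigma((\ell_1)^*,\ell_1)$; here $\mathfrak F\text{-}\lim_n z_n=z$ means that $\{n: z_n\in U\}\in\mathfrak F$ for every neighbourhood $U$ of $z$. Then the following conditions are equivalent: (i) $(a_n)_{n\in\mathbb N}\in\mathcal A(w^*,(\ell_1)^*,\mathfrak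 F)$; (ii) $\mathfrak F\text{-}\lim_n a_ne_n=0$ in the weak* topology of $\ell_\infty=(\ell_1)^*$; (iii) for every $\mathfrak F$-stationary set $I$, $0$ is a $\sigma(\ell_\infty,\ell_1)$-cluster point of $(a_ne_n)_{n\in I}$, i.e. every $\sigma(\ell_\infty,\ell_1)$-neighbourhood of $0$ contains $a_ne_n$ for infinitely many $n\in I$; (iv) for every $\mathfrak F$-stationary set $I$, $\sum_{n\in I}a_n^{-1}=\infty$. -/

import Mathlib

open Filter Topology
open scoped ENNReal

/-- A (proper) filter on `ℕ` is free if it contains the Fréchet filter, i.e. all cofinite sets.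
(In Mathlib's order on filters, `F ≤ G` means that every member of `G` is a member of `F`.) -/
def IsFreeFilter (F : Filter ℕ) : Prop :=
  F.NeBot ∧ F ≤ Filter.cofinite

/-- A set is `F`-stationary if it meets every member of `F`. -/
def IsFilterStationary (F : Filter ℕ) (I : Set ℕ) : Prop :=
  ∀ A ∈ F, (I ∩ A).Nonempty

/-- The collection `𝒜(w*, E*, F)` of `(w*, E*, F)`-acceptable sequences: sequences of positive reals
that are the norms of a sequence of functionals with weak* limit `0` along `F`. -/
def wStarAcceptable (𝕜 E : Type*) [RCLike 𝕜] [NormedAddCommGroup E] [NormedSpace 𝕜 E]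
    (F : Filter ℕ) : Set (ℕ → ℝ) :=
  {a | (∀ n, 0 < a n) ∧ ∃ x : ℕ → StrongDual 𝕜 E,
    (∀ n, ‖x n‖ = a n) ∧ Tendsto (fun n => StrongDual.toWeakDual (x n)) F (𝓝 0)}

/-- The space `ℓ_1` of absolutely summable scalar sequences. -/
abbrev EllOne (𝕜 : Type*) [RCLike 𝕜] : Type _ := lp (fun _ : ℕ => 𝕜) 1

/-- The space `ℓ_∞` of bounded scalar sequences. -/
abbrev EllInfty (𝕜 : Type*) [RCLike 𝕜] : Type _ := lp (fun _ : ℕ => 𝕜) ∞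

/-- The canonical identification of `ℓ_∞` with `(ℓ_1)*`, sending `y` to `x ↦ ∑ y_i x_i`. -/
noncomputable def ellInftyToDual (𝕜 : Type*) [RCLike 𝕜] :
    EllInfty 𝕜 →L[𝕜] StrongDual 𝕜 (EllOne 𝕜) :=
  lp.dualPairing ∞ 1 (fun _ => ContinuousLinearMap.mul 𝕜 𝕜) (K := 1)
    (fun _ => ContinuousLinearMap.opNorm_mul_le 𝕜 𝕜)

theorem ellInftyToDual_apply {𝕜 : Type*} [RCLike 𝕜] (y : EllInfty 𝕜) (x : EllOne 𝕜) :
    ellInftyToDual 𝕜 y x = ∑' i, y i * x i := rfl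

/-- The functional on `ℓ_1` given by `y ∈ ℓ_∞`, in the dual with its weak* topology
`σ(ℓ_∞, ℓ_1)`. -/
noncomputable def ellInftyToWeakDual (𝕜 : Type*) [RCLike 𝕜] (y : EllInfty 𝕜) :
    WeakDual 𝕜 (EllOne 𝕜) :=
  StrongDual.toWeakDual (ellInftyToDual 𝕜 y)

/-- The `n`-th vector of the canonical basis of `c_0`, seen in `ℓ_∞ ⊇ c_0`. -/
noncomputable def basisVec (𝕜 : Type*) [RCLike 𝕜] (n : ℕ) : EllInfty 𝕜 :=
  lp.single ∞ n (1 : 𝕜)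

/-- `x` is a cluster point of the subsequence `(u n)_{n ∈ I}`: every neighbourhood of `x` contains
`u n` for infinitely many `n ∈ I`. -/
def IsClusterPointAlong {X : Type*} [TopologicalSpace X] (x : X) (u : ℕ → X) (I : Set ℕ) : Prop :=
  ∀ U ∈ 𝓝 x, {n ∈ I | u n ∈ U}.Infinite

/-! Only (i) ⇒ (iv) is deep, and it holds on any Banach space. If `∑ ‖φ n‖⁻¹` converges over `I`, a
form of Ball's plank theorem gives one `x` with `1 ≤ ‖φ n x‖` on all of `I`
(`exists_one_le_norm_apply_of_summable_inv_norm`), so weak* convergence to `0` along `F` prevents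
`I` from being stationary. The plank theorem combines Bang's sign lemma with an extremal contraction
that makes the relevant matrix symmetric up to row weights; weak* compactness then passes from
finite to infinite families. The rest is elementary: `a n • e n` acts on `x` as `a n * x n`, the set
where this has modulus at least `δ` has summable `(a n)⁻¹`, and a summable `(a n)⁻¹` on `I` is
itself a test vector in `ℓ_1`. -/

/-! ### Finite plank theorem: signs and the extremal contraction. -/

/-- Bang's lemma: for a symmetric matrix there is a choice of signs for which each row of the
signed weighted sum is at least its diagonal term. -/
theorem exists_signs_diag_le_abs_sum {ι : Type*} [Fintype ι] [DecidableEq ι] (M : ι → ι → ℝ)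
    (hM : ∀ i j, M i j = M j i) (t : ι → ℝ) (ht : ∀ i, t i ≠ 0) :
    ∃ ε : ι → ℝ, (∀ i, ε i ^ 2 = 1) ∧ ∀ i, M i i * |t i| ≤ |∑ j, M i j * (t j * ε j)| := by
  let σ : (ι → Bool) → ι → ℝ := fun s i => if s i then 1 else -1
  have hσ : ∀ s i, σ s i ^ 2 = 1 := fun s i => by simp only [σ]; split_ifs <;> norm_num
  -- Maximise the quadratic form over all signs; flipping the single sign `i` cannot increase it,
  -- which is the claim for row `i`.
  obtain ⟨s, hs⟩ := Finite.exists_max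
    (fun s : ι → Bool => ∑ i, ∑ j, M i j * (t i * σ s i) * (t j * σ s j))
  refine ⟨σ s, hσ s, fun i => ?_⟩
  set v : ι → ℝ := fun j => t j * σ s j with hv
  have hflip : ∀ j, t j * σ (Function.update s i (!s i)) j = v j - if j = i then 2 * v i else 0 := by
    intro j
    by_cases h : j = i
    · subst h
      simp only [σ, hv, Function.update_self, if_true]
      cases s j <;> simp <;> ring
    · simp [σ, hv, h]
  have h := hs (Function.update s i (!s i))
  simp only [hflip] at h
  have e : ∑ k, ∑ j, M k j * (v k - if k = i then 2 * v i else 0) *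
      (v j - if j = i then 2 * v i else 0) =
      ∑ k, ∑ j, M k j * v k * v j - 4 * v i * ∑ j, M i j * v j + 4 * M i i * v i ^ 2 := by
    have e1 : ∀ k j, M k j * (v k - if k = i then 2 * v i else 0) *
        (v j - if j = i then 2 * v i else 0) = M k j * v k * v j
        - (if k = i then 2 * v i * (M i j * v j) else 0)
        - (if j = i then 2 * v i * (M i k * v k) else 0)
        + (if k = i then (if j = i then 4 * M i i * v i ^ 2 else 0) else 0) := by
      intro k j
      split_ifs with h1 h2 h2
      · subst h1; subst h2; ring
      · subst h1; ring
      · subst h2; rw [hM k j]; ring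
      · ring
    simp only [e1, Finset.sum_add_distrib, Finset.sum_sub_distrib, Finset.sum_ite_irrel,
      Finset.sum_const_zero, Finset.sum_ite_eq', Finset.mem_univ, if_true, ← Finset.mul_sum]
    ring
  rw [e] at h
  have hv2 : v i ^ 2 = |t i| ^ 2 := by simp only [hv]; rw [mul_pow, hσ, mul_one, sq_abs]
  have hvi : |v i| = |t i| := by
    rw [← sq_eq_sq₀ (abs_nonneg _) (abs_nonneg _), sq_abs, hv2]
  have h2 : M i i * |t i| ^ 2 ≤ v i * ∑ j, M i j * v j := by rw [← hv2]; linarith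
  have h3 : v i * ∑ j, M i j * v j ≤ |t i| * |∑ j, M i j * v j| := by
    rw [← hvi, ← abs_mul]; exact le_abs_self _
  have h4 := abs_pos.2 (ht i)
  refine le_of_mul_le_mul_left ?_ h4
  linarith

/-- First-order condition for a normalised sum of inverse squares at a local minimum. -/
theorem sum_div_cube_eq_zero_of_local_min {ι : Type*} [Fintype ι] (w p q : ι → ℝ) (K : ℝ)
    (hp : ∀ k, p k ≠ 0)
    (h : ∀ᶠ s in 𝓝 (0 : ℝ), ∑ k, w k ^ 2 / p k ^ 2 ≤
      (1 + s ^ 2 * K) * ∑ k, w k ^ 2 / (p k + s * q k) ^ 2) :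
    ∑ k, w k ^ 2 / p k ^ 3 * q k = 0 := by
  have hd : HasDerivAt (fun s : ℝ => (1 + s ^ 2 * K) * ∑ k, w k ^ 2 / (p k + s * q k) ^ 2)
      (-2 * ∑ k, w k ^ 2 / p k ^ 3 * q k) 0 := by
    have h1 : ∀ k, HasDerivAt (fun s : ℝ => w k ^ 2 / (p k + s * q k) ^ 2)
        (-2 * (w k ^ 2 / p k ^ 3 * q k)) 0 := by
      intro k
      have a : HasDerivAt (fun s : ℝ => p k + s * q k) (q k) 0 := by
        simpa using ((hasDerivAt_id (0 : ℝ)).mul_const (q k)).const_add (p k)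
      have b := (a.pow 2).inv (by simpa using hp k)
      have c := b.const_mul (w k ^ 2)
      refine c.congr_deriv ?_
      have := hp k
      simp only [Pi.pow_apply, zero_mul, add_zero, Nat.cast_ofNat, Nat.add_one_sub_one, pow_one]
      field_simp
    have h2 := HasDerivAt.fun_sum (u := Finset.univ) (fun k _ => h1 k)
    have h3 : HasDerivAt (fun s : ℝ => 1 + s ^ 2 * K) 0 0 := by
      simpa using (((hasDerivAt_id (0 : ℝ)).pow 2).mul_const K).const_add 1
    refine (h3.mul h2).congr_deriv ?_
    rw [← Finset.mul_sum]
    ring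
  have hm : IsLocalMin (fun s : ℝ => (1 + s ^ 2 * K) * ∑ k, w k ^ 2 / (p k + s * q k) ^ 2) 0 := by
    filter_upwards [h] with s hs
    simpa using hs
  have := hm.hasDerivAt_eq_zero hd
  linarith

/-- Skewness kills the cross term, so normalising `1 + s • S` to a contraction costs only second
order in `s`. -/
theorem norm_id_add_smul_skew_sq_le {H : Type*} [NormedAddCommGroup H] [InnerProductSpace ℝ H]
    (S : H →L[ℝ] H) (hS : ∀ v, inner ℝ (S v) v = 0) (s : ℝ) (v : H) :
    ‖v + s • S v‖ ^ 2 ≤ (1 + s ^ 2 * ‖S‖ ^ 2) * ‖v‖ ^ 2 := by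
  rw [norm_add_sq_real, inner_smul_right, real_inner_comm, hS, norm_smul, Real.norm_eq_abs, mul_pow,
    sq_abs]
  have := pow_le_pow_left₀ (norm_nonneg _) (S.le_opNorm v) 2
  nlinarith [mul_le_mul_of_nonneg_left this (sq_nonneg s)]

/-- The optimal contraction in Ball's proof of the plank theorem. -/
theorem exists_contraction_symmetric {ι : Type*} [Fintype ι] [DecidableEq ι]
    (b : ι → EuclideanSpace ℝ ι) (w : ι → ℝ) (hw : ∀ i, 0 < w i)
    (hb : ∀ i, √(w i) ≤ b i i) :
    ∃ T : EuclideanSpace ℝ ι →L[ℝ] EuclideanSpace ℝ ι, ‖T‖ ≤ 1 ∧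
      ∃ P : ι → ι → ℝ, (∀ i j, P i j = inner ℝ (b i) (T (EuclideanSpace.single j 1))) ∧
      (∀ i, P i i ≠ 0) ∧ ∑ i, w i ^ 2 / P i i ^ 2 ≤ ∑ i, w i ∧
      ∀ i j, w i ^ 2 / P i i ^ 3 * P i j = w j ^ 2 / P j j ^ 3 * P j i := by
  let E := EuclideanSpace ℝ ι
  let e : ι → E := fun i => EuclideanSpace.single i 1
  have hin : ∀ (x : E) i, inner ℝ x (e i) = x i := fun x i => by
    simpa using EuclideanSpace.inner_single_right (𝕜 := ℝ) i 1 x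
  let P : (E →L[ℝ] E) → ι → ι → ℝ := fun T i j => inner ℝ (b i) (T (e j))
  have hPc : ∀ i j, Continuous fun T => P T i j := fun i j => by
    simp only [P]; fun_prop
  set W := ∑ i, w i with hW
  have hW0 : 0 ≤ W := Finset.sum_nonneg fun i _ => (hw i).le
  -- The constraint keeps `P T i i` away from `0`, so the objective is continuous on a compact set.
  -- With `W + 1` in place of `W` it is strict at the minimiser, hence inactive under small
  -- perturbations.
  let C : Set (E →L[ℝ] E) := Metric.closedBall 0 1 ∩ {T | ∀ i, w i ^ 2 ≤ (W + 1) * P T i i ^ 2}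
  have hC : IsCompact C := by
    have : ProperSpace (E →L[ℝ] E) := FiniteDimensional.proper ℝ _
    refine (isCompact_closedBall _ _).inter_right ?_
    simp only [Set.ofPred_forall]
    exact isClosed_iInter fun i =>
      isClosed_le continuous_const (continuous_const.mul ((hPc i i).pow 2))
  have hne : ∀ T ∈ C, ∀ i, P T i i ≠ 0 := by
    intro T hT i h0
    have := hT.2 i
    rw [h0] at this
    nlinarith [hw i, pow_pos (hw i) 2]
  have hP1 : ∀ i, w i ≤ P (ContinuousLinearMap.id ℝ E) i i ^ 2 := by
    intro i
    have h1 : P (ContinuousLinearMap.id ℝ E) i i = b i i := hin _ _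
    rw [h1, ← Real.sq_sqrt (hw i).le]
    exact pow_le_pow_left₀ (Real.sqrt_nonneg _) (hb i) 2
  have h1C : ContinuousLinearMap.id ℝ E ∈ C := by
    refine ⟨by simpa using ContinuousLinearMap.norm_id_le, fun i => ?_⟩
    have h2 : w i ≤ W := Finset.single_le_sum (fun i _ => (hw i).le) (Finset.mem_univ i)
    have := hw i
    nlinarith [hP1 i]
  let f : (E →L[ℝ] E) → ℝ := fun T => ∑ i, w i ^ 2 / P T i i ^ 2
  have hf : ContinuousOn f C := by
    refine continuousOn_finsetSum _ fun i _ => ?_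
    exact continuousOn_const.div ((hPc i i).pow 2).continuousOn
      fun T hT => pow_ne_zero 2 (hne T hT i)
  obtain ⟨T, hTC, hTmin⟩ := hC.exists_isMinOn ⟨_, h1C⟩ hf
  have hTW : f T ≤ W := by
    refine (hTmin h1C).trans (Finset.sum_le_sum fun i _ => ?_)
    have := hw i
    rw [div_le_iff₀ (lt_of_lt_of_le this (hP1 i))]
    nlinarith [hP1 i]
  have hstrict : ∀ i, w i ^ 2 < (W + 1) * P T i i ^ 2 := by
    intro i
    have h1 : w i ^ 2 / P T i i ^ 2 ≤ W :=
      (Finset.single_le_sum (f := fun i => w i ^ 2 / P T i i ^ 2) (fun i _ => by positivity)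
        (Finset.mem_univ i)).trans hTW
    have h2 : 0 < P T i i ^ 2 := by have := hne T hTC i; positivity
    rw [div_le_iff₀ h2] at h1
    nlinarith
  have hTn : ‖T‖ ≤ 1 := by simpa using hTC.1
  refine ⟨T, hTn, P T, fun _ _ => rfl, hne T hTC, hTW, fun i j => ?_⟩
  by_cases hij : i = j
  · rw [hij]
  -- Infinitesimal rotation in the `(i, j)` plane: stationarity of the minimiser in this direction
  -- is exactly the symmetry relation for `i` and `j`.
  let S : E →L[ℝ] E := (innerSL ℝ (e i)).smulRight (e j) - (innerSL ℝ (e j)).smulRight (e i)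
  have hSv : ∀ v, S v = inner ℝ (e i) v • e j - inner ℝ (e j) v • e i := fun v => rfl
  have hS : ∀ v, inner ℝ (S v) v = 0 := by
    intro v
    rw [hSv, inner_sub_left, inner_smul_left, inner_smul_left]
    simp [mul_comm]
  let q : ι → ℝ := fun k => inner ℝ (b k) (T (S (e k)))
  let c : ℝ → ℝ := fun s => (√(1 + s ^ 2 * ‖S‖ ^ 2))⁻¹
  have hpos : ∀ s : ℝ, 0 < 1 + s ^ 2 * ‖S‖ ^ 2 := fun s => by positivity
  let R : ℝ → E →L[ℝ] E := fun s => c s • (T ∘L (ContinuousLinearMap.id ℝ E + s • S))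
  have hR : ∀ s k, P (R s) k k = c s * (P T k k + s * q k) := by
    intro s k
    simp [P, R, q, inner_smul_right, inner_add_right, mul_add]
  have hRn : ∀ s, ‖R s‖ ≤ 1 := by
    intro s
    have hb : ‖ContinuousLinearMap.id ℝ E + s • S‖ ≤ √(1 + s ^ 2 * ‖S‖ ^ 2) := by
      refine ContinuousLinearMap.opNorm_le_bound _ (Real.sqrt_nonneg _) fun v => ?_
      rw [← Real.sqrt_sq (norm_nonneg v), ← Real.sqrt_mul (hpos s).le]
      exact Real.le_sqrt_of_sq_le (norm_id_add_smul_skew_sq_le S hS s v)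
    have hc : 0 < √(1 + s ^ 2 * ‖S‖ ^ 2) := Real.sqrt_pos.2 (hpos s)
    have h1 := (T.opNorm_comp_le (ContinuousLinearMap.id ℝ E + s • S)).trans
      (mul_le_mul hTn hb (norm_nonneg _) zero_le_one)
    simp only [R, c, norm_smul, norm_inv, Real.norm_eq_abs, abs_of_pos hc]
    rw [inv_mul_le_iff₀ hc]
    linarith
  have hcc : ContinuousAt c 0 := by
    refine Continuous.continuousAt ?_
    exact Continuous.inv₀ (by fun_prop) fun s => (Real.sqrt_pos.2 (hpos s)).ne'
  have hev : ∀ᶠ s in 𝓝 (0 : ℝ), R s ∈ C := by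
    have : ∀ k, ∀ᶠ s in 𝓝 (0 : ℝ), w k ^ 2 < (W + 1) * P (R s) k k ^ 2 := by
      intro k
      have hcont : ContinuousAt (fun s => (W + 1) * P (R s) k k ^ 2) 0 := by
        simp only [hR]
        fun_prop
      refine hcont.eventually (lt_mem_nhds ?_)
      beta_reduce
      rw [hR]
      simpa [c] using hstrict k
    filter_upwards [eventually_all.2 this] with s hs
    exact ⟨by simpa using hRn s, fun k => (hs k).le⟩
  have hzero : ∑ k, w k ^ 2 / P T k k ^ 3 * q k = 0 := by
    refine sum_div_cube_eq_zero_of_local_min w (fun k => P T k k) q (‖S‖ ^ 2) (hne T hTC) ?_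
    filter_upwards [hev] with s hs
    refine (hTmin hs).trans_eq ?_
    simp only [f, hR, c, Finset.mul_sum]
    refine Finset.sum_congr rfl fun k _ => ?_
    rw [mul_pow, inv_pow, Real.sq_sqrt (hpos s).le, div_mul_eq_div_div_swap, div_inv_eq_mul,
      mul_comm]
  have hq : ∀ k, q k = (if k = i then P T i j else 0) - (if k = j then P T j i else 0) := by
    intro k
    have h1 : ∀ l m : ι, inner ℝ (e l) (e m) = if m = l then (1 : ℝ) else 0 := by
      intro l m
      rw [hin]
      simp [e, eq_comm]
    simp only [q, hSv, h1, P]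
    split_ifs with h2 h3 h3 <;> simp_all
  simp only [hq, mul_sub, Finset.sum_sub_distrib, mul_ite, mul_zero, Finset.sum_ite_eq',
    Finset.mem_univ, if_true] at hzero
  linarith

/-- **Ball's plank theorem** for finitely many centred planks, in Hilbertian form. -/
theorem exists_le_abs_inner_of_finite {ι : Type*} [Fintype ι] [DecidableEq ι]
    (b : ι → EuclideanSpace ℝ ι) (w : ι → ℝ) (hw : ∀ i, 0 < w i)
    (hb : ∀ i, √(w i) ≤ b i i) :
    ∃ μ : EuclideanSpace ℝ ι, ‖μ‖ ^ 2 ≤ ∑ i, w i ∧ ∀ i, w i ≤ |inner ℝ (b i) μ| := by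
  obtain ⟨T, hT, P, hP, hne, hsum, hsymm⟩ := exists_contraction_symmetric b w hw hb
  -- With `t i = w i / P i i`, the diagonal bound becomes `w i` once the row weight is cancelled,
  -- and `∑ t i ^ 2` is the minimised quantity.
  obtain ⟨ε, hε, hM⟩ := exists_signs_diag_le_abs_sum
    (fun i j => w i ^ 2 / P i i ^ 3 * P i j) hsymm (fun i => w i / P i i)
    (fun i => div_ne_zero (hw i).ne' (hne i))
  let v : EuclideanSpace ℝ ι := WithLp.toLp 2 fun i => w i / P i i * ε i
  have hv : v = ∑ j, (w j / P j j * ε j) • EuclideanSpace.single j (1 : ℝ) := by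
    ext k
    simp [v, Pi.single_apply]
  have hvn : ‖v‖ ^ 2 ≤ ∑ i, w i := by
    refine le_trans (le_of_eq ?_) hsum
    rw [EuclideanSpace.real_norm_sq_eq]
    refine Finset.sum_congr rfl fun i _ => ?_
    simp [v, mul_pow, hε, div_pow]
  refine ⟨T v, ?_, fun i => ?_⟩
  · refine le_trans (pow_le_pow_left₀ (norm_nonneg _) (T.le_of_opNorm_le hT v) 2) ?_
    rwa [one_mul]
  · have hin : inner ℝ (b i) (T v) = ∑ j, P i j * (w j / P j j * ε j) := by
      rw [hv, map_sum, inner_sum]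
      refine Finset.sum_congr rfl fun j _ => ?_
      rw [map_smul, inner_smul_right, hP i j, mul_comm]
    have h := hM i
    simp only [mul_assoc] at h
    rw [← Finset.mul_sum, abs_mul, ← hin] at h
    have hw' := hw i
    have hp := abs_pos.2 (hne i)
    have h3 : |w i ^ 2 / P i i ^ 3| = w i ^ 2 / |P i i| ^ 3 := by
      rw [abs_div, abs_pow, abs_pow, abs_of_pos hw']
    have h4 : w i ^ 2 / P i i ^ 3 * (P i i * |w i / P i i|) = w i ^ 2 / |P i i| ^ 3 * w i := by
      rw [abs_div, abs_of_pos hw']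
      have := hne i
      rw [show |P i i| ^ 3 = |P i i| * P i i ^ 2 by rw [pow_succ, sq_abs, mul_comm]]
      field_simp
    rw [h3, h4] at h
    exact le_of_mul_le_mul_left h (by positivity)

/-! ### Infinite families and Banach spaces. -/

/-- **Ball's plank theorem** for a family of centred planks of summable widths, in `ℓ²`. -/
theorem exists_le_abs_inner_lp_two {ι : Type*} (b : ι → lp (fun _ : ι => ℝ) 2) (w : ι → ℝ)
    (hw : ∀ i, 0 < w i) (hsum : Summable w) (hb : ∀ i, √(w i) ≤ b i i) :
    ∃ μ : lp (fun _ : ι => ℝ) 2, ∀ i, w i ≤ |inner ℝ (b i) μ| := by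
  classical
  let H := lp (fun _ : ι => ℝ) 2
  -- The radius does not depend on the finite subfamily, so Banach–Alaoglu and the finite
  -- intersection property apply.
  let K : Set (WeakDual ℝ H) :=
    WeakDual.toStrongDual ⁻¹' Metric.closedBall (0 : StrongDual ℝ H) √(∑' i, w i)
  let t : ι → Set (WeakDual ℝ H) := fun i => {ψ | w i ≤ |ψ (b i)|}
  have ht : ∀ i, IsClosed (t i) := fun i =>
    isClosed_le continuous_const (WeakDual.eval_continuous (b i)).abs
  obtain ⟨ψ, -, hψ⟩ := (WeakDual.isCompact_closedBall (𝕜 := ℝ) (E := H) 0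
      √(∑' i, w i)).inter_iInter_nonempty t ht fun u => by
    obtain ⟨ν, hν, hνw⟩ := exists_le_abs_inner_of_finite
      (fun i : u => WithLp.toLp 2 fun j : u => b i j) (fun i : u => w i) (fun i => hw i)
      (fun i => hb i)
    let g : ι → ℝ := fun i => if h : i ∈ u then ν ⟨i, h⟩ else 0
    have hg : ∀ i : u, g i = ν i := fun i => by simp [g]
    let y : H := ∑ i ∈ u, lp.single 2 i (g i)
    have hy : ‖y‖ ^ 2 ≤ ∑' i, w i := by
      have h1 := lp.norm_sum_single (E := fun _ : ι => ℝ) (p := 2) (by simp) g u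
      simp only [ENNReal.toReal_ofNat, Real.rpow_ofNat] at h1
      rw [h1, ← Finset.sum_coe_sort]
      simp only [hg, Real.norm_eq_abs, sq_abs]
      rw [← EuclideanSpace.real_norm_sq_eq]
      refine hν.trans ?_
      rw [Finset.sum_coe_sort u w]
      exact hsum.sum_le_tsum u fun i _ => (hw i).le
    have hin : ∀ i : u, inner ℝ (b i) y =
        inner ℝ (WithLp.toLp 2 fun j : u => b i j : EuclideanSpace ℝ u) ν := by
      intro i
      simp only [y, inner_sum, lp.inner_single_right]
      rw [← Finset.sum_coe_sort, PiLp.inner_apply]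
      simp only [hg]
    refine ⟨StrongDual.toWeakDual (InnerProductSpace.toDual ℝ H y), ?_, ?_⟩
    · refine mem_closedBall_zero_iff.2 ?_
      exact ((InnerProductSpace.toDual ℝ H).norm_map y).trans_le (Real.le_sqrt_of_sq_le hy)
    · refine Set.mem_iInter₂.2 fun i hi => ?_
      have h2 := hνw ⟨i, hi⟩
      rw [← hin ⟨i, hi⟩, real_inner_comm] at h2
      exact h2
  refine ⟨(InnerProductSpace.toDual ℝ H).symm (WeakDual.toStrongDual ψ), fun i => ?_⟩
  have := Set.mem_iInter.1 hψ i
  rw [real_inner_comm, InnerProductSpace.toDual_symm_apply]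
  exact this

/-- A family of functionals whose inverse norms are summable is bounded away from zero at
some point. -/
theorem exists_one_le_norm_apply_of_summable_inv_norm {𝕜 E ι : Type*} [RCLike 𝕜]
    [NormedAddCommGroup E] [NormedSpace 𝕜 E] [CompleteSpace E] (φ : ι → StrongDual 𝕜 E)
    (hφ : ∀ i, φ i ≠ 0) (hsum : Summable fun i => ‖φ i‖⁻¹) :
    ∃ x : E, ∀ i, 1 ≤ ‖φ i x‖ := by
  let _ : NormedSpace ℝ E := NormedSpace.restrictScalars ℝ 𝕜 E
  have hpos : ∀ i, 0 < ‖φ i‖ := fun i => norm_pos_iff.2 (hφ i)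
  -- The norm of `φ i` need not be attained; the factor `2` pays for that.
  have hx : ∀ i, ∃ x : E, ‖x‖ ≤ 2 ∧ φ i x = (‖φ i‖ : 𝕜) := by
    intro i
    obtain ⟨x, hx1, hx⟩ := (φ i).exists_lt_apply_of_lt_opNorm (half_lt_self (hpos i))
    have hx0 : φ i x ≠ 0 := norm_pos_iff.1 ((half_pos (hpos i)).trans hx)
    refine ⟨((‖φ i‖ : 𝕜) / φ i x) • x, ?_, by simp [hx0]⟩
    rw [norm_smul, norm_div, RCLike.norm_ofReal, abs_norm, div_mul_eq_mul_div,
      div_le_iff₀ (norm_pos_iff.2 hx0)]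
    nlinarith [hpos i]
  choose x hx2 hx using hx
  let w : ι → ℝ := fun i => ‖φ i‖⁻¹
  have hw : ∀ i, 0 < w i := fun i => inv_pos.2 (hpos i)
  have hA : ∀ i j, |RCLike.re (φ i (x j))| ≤ 2 * ‖φ i‖ := fun i j =>
    (RCLike.abs_re_le_norm _).trans (((φ i).le_opNorm _).trans
      (by nlinarith [hx2 j, norm_nonneg (φ i)]))
  have hs : Memℓp (fun j => √(w j)) 2 := by
    refine memℓp_gen ?_
    simpa [Real.sq_sqrt (hw _).le] using hsum
  have hmem : ∀ i, Memℓp (fun j => w i * RCLike.re (φ i (x j)) * √(w j)) 2 := by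
    intro i
    refine memℓp_gen ?_
    simp only [ENNReal.toReal_ofNat, Real.rpow_ofNat, Real.norm_eq_abs, sq_abs]
    refine Summable.of_nonneg_of_le (fun j => sq_nonneg _) (fun j => ?_) (hsum.mul_left 4)
    rw [mul_pow, Real.sq_sqrt (hw j).le]
    refine mul_le_mul_of_nonneg_right ?_ (hw j).le
    have h1 : |w i * RCLike.re (φ i (x j))| ≤ 2 := by
      rw [abs_mul, abs_of_pos (hw i), inv_mul_le_iff₀ (hpos i), mul_comm]
      exact hA i j
    nlinarith [sq_abs (w i * RCLike.re (φ i (x j))), abs_nonneg (w i * RCLike.re (φ i (x j)))]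
  -- The scaling makes the diagonal exactly `√(w i)`, while `inner (b i) μ` is `w i` times the real
  -- part of `φ i` at `∑ √(w j) μ j x j`.
  obtain ⟨μ, hμ⟩ := exists_le_abs_inner_lp_two
    (fun i => (⟨_, hmem i⟩ : lp (fun _ : ι => ℝ) 2)) w hw hsum (fun i => by
      change _ ≤ w i * RCLike.re (φ i (x i)) * √(w i)
      rw [hx, RCLike.ofReal_re, inv_mul_cancel₀ (hpos i).ne', one_mul])
  have hsx : Summable fun j => (√(w j) * μ j) • x j := by
    have h1 := lp.summable_mul (p := 2) (q := 2)
      (by simpa using Real.HolderConjugate.two_two) ⟨_, hs⟩ μ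
    refine Summable.of_norm_bounded (h1.mul_right 2) fun j => ?_
    rw [norm_smul, norm_mul]
    exact mul_le_mul_of_nonneg_left (hx2 j) (by positivity)
  refine ⟨∑' j, (√(w j) * μ j) • x j, fun i => ?_⟩
  let ρ : E →L[ℝ] ℝ := RCLike.reCLM.comp ((φ i).restrictScalars ℝ)
  have hρ : inner ℝ (⟨_, hmem i⟩ : lp (fun _ : ι => ℝ) 2) μ =
      w i * RCLike.re (φ i (∑' j, (√(w j) * μ j) • x j)) := by
    change _ = w i * ρ _
    rw [ρ.map_tsum hsx, ← tsum_mul_left, lp.inner_eq_tsum]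
    refine tsum_congr fun j => ?_
    rw [map_smul]
    change μ j * (w i * RCLike.re (φ i (x j)) * √(w j)) =
      w i * ((√(w j) * μ j) * RCLike.re (φ i (x j)))
    ring
  have h := hμ i
  rw [hρ, abs_mul, abs_of_pos (hw i)] at h
  exact ((le_mul_iff_one_le_right (hw i)).1 h).trans (RCLike.abs_re_le_norm _)

/-! ### Weak* convergence and the four conditions. -/

theorem tendsto_weakDual_zero_iff {𝕜 E α : Type*} [RCLike 𝕜] [NormedAddCommGroup E]
    [NormedSpace 𝕜 E] {l : Filter α} {f : α → StrongDual 𝕜 E} :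
    Tendsto (fun i => StrongDual.toWeakDual (f i)) l (𝓝 0) ↔
      ∀ x, Tendsto (fun i => f i x) l (𝓝 0) :=
  tendsto_iff_forall_eval_tendsto_topDualPairing

theorem IsFilterStationary.tsum_inv_eq_top_of_mem_wStarAcceptable {𝕜 E : Type*} [RCLike 𝕜]
    [NormedAddCommGroup E] [NormedSpace 𝕜 E] [CompleteSpace E] {F : Filter ℕ} {a : ℕ → ℝ}
    {I : Set ℕ} (hI : IsFilterStationary F I) (ha : a ∈ wStarAcceptable 𝕜 E F) :
    ∑' n : I, ENNReal.ofReal (a n)⁻¹ = ∞ := by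
  obtain ⟨ha, φ, hφ, hlim⟩ := ha
  by_contra hne
  have hsum : Summable fun n : I => ‖φ n‖⁻¹ := by
    simp only [hφ]
    refine (ENNReal.summable_toReal hne).congr fun n => ?_
    exact ENNReal.toReal_ofReal (inv_pos.2 (ha n)).le
  obtain ⟨x, hx⟩ := exists_one_le_norm_apply_of_summable_inv_norm (fun n : I => φ n)
    (fun n => norm_pos_iff.1 (by rw [hφ]; exact ha n)) hsum
  have h := (tendsto_weakDual_zero_iff.1 hlim x).norm
  rw [norm_zero] at h
  obtain ⟨n, hnI, hn⟩ := hI _ (h.eventually (gt_mem_nhds zero_lt_one))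
  exact absurd (hx ⟨n, hnI⟩) (not_le.2 hn)

theorem ellInftyToDual_smul_basisVec_apply {𝕜 : Type*} [RCLike 𝕜] (c : 𝕜) (n : ℕ)
    (x : EllOne 𝕜) : ellInftyToDual 𝕜 (c • basisVec 𝕜 n) x = c * x n := by
  rw [ellInftyToDual_apply, tsum_eq_single n]
  · simp [basisVec]
  · intro m hm
    simp [basisVec, hm]

theorem norm_ellInftyToDual_smul_basisVec {𝕜 : Type*} [RCLike 𝕜] (c : 𝕜) (n : ℕ) :
    ‖ellInftyToDual 𝕜 (c • basisVec 𝕜 n)‖ = ‖c‖ := by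
  refine le_antisymm (ContinuousLinearMap.opNorm_le_bound _ (norm_nonneg _) fun x => ?_) ?_
  · rw [ellInftyToDual_smul_basisVec_apply, norm_mul]
    exact mul_le_mul_of_nonneg_left (lp.norm_apply_le_norm one_ne_zero x n) (norm_nonneg _)
  · have h := (ellInftyToDual 𝕜 (c • basisVec 𝕜 n)).le_opNorm
      (lp.single 1 n (1 : 𝕜) : EllOne 𝕜)
    rw [ellInftyToDual_smul_basisVec_apply, lp.norm_single one_pos] at h
    simpa using h

theorem tendsto_ellInftyToWeakDual_basisVec_iff {𝕜 : Type*} [RCLike 𝕜] {F : Filter ℕ}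
    {a : ℕ → ℝ} :
    Tendsto (fun n => ellInftyToWeakDual 𝕜 ((a n : 𝕜) • basisVec 𝕜 n)) F (𝓝 0) ↔
      ∀ x : EllOne 𝕜, Tendsto (fun n => (a n : 𝕜) * x n) F (𝓝 0) := by
  simp only [ellInftyToWeakDual, tendsto_weakDual_zero_iff, ellInftyToDual_smul_basisVec_apply]

theorem EllOne.summable_norm {𝕜 : Type*} [RCLike 𝕜] (x : EllOne 𝕜) : Summable fun n => ‖x n‖ := by
  simpa using (lp.memℓp x).summable (by simp)

theorem tendsto_ellInftyToWeakDual_basisVec_of_tsum_inv_eq_top {𝕜 : Type*} [RCLike 𝕜]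
    {F : Filter ℕ} {a : ℕ → ℝ} (ha : ∀ n, 0 < a n)
    (h : ∀ I : Set ℕ, IsFilterStationary F I → ∑' n : I, ENNReal.ofReal (a n)⁻¹ = ∞) :
    Tendsto (fun n => ellInftyToWeakDual 𝕜 ((a n : 𝕜) • basisVec 𝕜 n)) F (𝓝 0) := by
  refine tendsto_ellInftyToWeakDual_basisVec_iff.2 fun x => ?_
  rw [Metric.tendsto_nhds]
  intro δ hδ
  by_contra hA
  -- If convergence fails at `x`, this exceptional set is stationary, yet on it `(a n)⁻¹ ≤ δ⁻¹ * ‖x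
  -- n‖`.
  refine Summable.tsum_ofReal_ne_top ?_ (h {n | ¬ dist ((a n : 𝕜) * x n) 0 < δ} fun B hB => ?_)
  · refine Summable.of_nonneg_of_le (fun n => (inv_pos.2 (ha n)).le) (fun n => ?_)
      (((EllOne.summable_norm x).subtype _).mul_left δ⁻¹)
    have hn := n.2
    simp only [Set.mem_ofPred_eq, dist_zero_right, norm_mul, RCLike.norm_ofReal,
      abs_of_pos (ha n), not_lt] at hn
    simp only [Function.comp_apply]
    rw [inv_le_iff_one_le_mul₀ (ha n), mul_assoc, ← div_eq_inv_mul, le_div_iff₀ hδ, one_mul]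
    linarith
  · by_contra hne
    refine hA (mem_of_superset hB fun n hn => ?_)
    by_contra hn'
    exact hne ⟨n, hn', hn⟩

/-- Freeness lets finitely many indices be removed from a member of `F`, so meeting once forces
meeting infinitely often. -/
theorem IsFilterStationary.isClusterPointAlong {X : Type*} [TopologicalSpace X] {F : Filter ℕ}
    (hF : IsFreeFilter F) {I : Set ℕ} (hI : IsFilterStationary F I) {u : ℕ → X} {x : X}
    (hu : Tendsto u F (𝓝 x)) : IsClusterPointAlong x u I := by
  intro U hU hfin
  obtain ⟨n, hnI, hnU, hn⟩ := hI _ (inter_mem (hu hU) (hF.2 hfin.compl_mem_cofinite))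
  exact hn ⟨hnI, hnU⟩

theorem tsum_inv_eq_top_of_isClusterPointAlong {𝕜 : Type*} [RCLike 𝕜] {a : ℕ → ℝ}
    (ha : ∀ n, 0 < a n) {I : Set ℕ}
    (h : IsClusterPointAlong 0 (fun n => ellInftyToWeakDual 𝕜 ((a n : 𝕜) • basisVec 𝕜 n)) I) :
    ∑' n : I, ENNReal.ofReal (a n)⁻¹ = ∞ := by
  classical
  by_contra hne
  have hsum : Summable fun n : I => (a n)⁻¹ :=
    (ENNReal.summable_toReal hne).congr fun n => ENNReal.toReal_ofReal (inv_pos.2 (ha n)).le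
  -- On this vector every `a n • e n` with `n ∈ I` takes the value `1`.
  let y : ℕ → 𝕜 := I.indicator fun n => ((a n)⁻¹ : ℝ)
  have hy : Memℓp y 1 := by
    refine memℓp_gen ?_
    simp only [ENNReal.toReal_one, Real.rpow_one, y, norm_indicator_eq_indicator_norm]
    refine summable_subtype_iff_indicator.1 (hsum.congr fun n => ?_)
    simp [abs_of_pos (ha n)]
  let x : EllOne 𝕜 := ⟨y, hy⟩
  have hU : {ψ : WeakDual 𝕜 (EllOne 𝕜) | ‖ψ x‖ < 1} ∈ 𝓝 0 := by
    refine (isOpen_lt (WeakDual.eval_continuous x).norm continuous_const).mem_nhds ?_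
    change ‖(0 : 𝕜)‖ < 1
    simp
  obtain ⟨n, hnI, hn⟩ := (h _ hU).nonempty
  have h1 : ‖ellInftyToDual 𝕜 ((a n : 𝕜) • basisVec 𝕜 n) x‖ < 1 := hn
  rw [ellInftyToDual_smul_basisVec_apply] at h1
  have h2 : x n = ((a n)⁻¹ : ℝ) :=
    Set.indicator_of_mem hnI fun m => (((a m)⁻¹ : ℝ) : 𝕜)
  have h3 : (a n : 𝕜) ≠ 0 := RCLike.ofReal_ne_zero.2 (ha n).ne'
  rw [h2, RCLike.ofReal_inv, mul_inv_cancel₀ h3, norm_one] at h1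
  exact lt_irrefl _ h1

theorem mainTheorem9 (𝕜 : Type*) [RCLike 𝕜] (F : Filter ℕ) (hF : IsFreeFilter F)
    (a : ℕ → ℝ) (ha : ∀ n, 0 < a n) :
    List.TFAE [
      a ∈ wStarAcceptable 𝕜 (EllOne 𝕜) F,
      Tendsto (fun n => ellInftyToWeakDual 𝕜 ((a n : 𝕜) • basisVec 𝕜 n)) F (𝓝 0),
      ∀ I : Set ℕ, IsFilterStationary F I →
        IsClusterPointAlong 0 (fun n => ellInftyToWeakDual 𝕜 ((a n : 𝕜) • basisVec 𝕜 n)) I,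
      ∀ I : Set ℕ, IsFilterStationary F I →
        ∑' n : I, ENNReal.ofReal ((a n)⁻¹) = ∞] := by
  tfae_have 1 → 4 := fun h I hI => hI.tsum_inv_eq_top_of_mem_wStarAcceptable h
  tfae_have 4 → 2 := tendsto_ellInftyToWeakDual_basisVec_of_tsum_inv_eq_top ha
  tfae_have 2 → 3 := fun h I hI => hI.isClusterPointAlong hF h
  tfae_have 3 → 4 := fun h I hI => tsum_inv_eq_top_of_isClusterPointAlong ha (h I hI)
  tfae_have 2 → 1 := fun h =>
    ⟨ha, fun n => ellInftyToDual 𝕜 ((a n : 𝕜) • basisVec 𝕜 n), fun n => by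
      rw [norm_ellInftyToDual_smul_basisVec, RCLike.norm_ofReal, abs_of_pos (ha n)], h⟩
  tfae_finish
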